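/- Let $\mathcal H$ be a real Hilbert space. Set-valued operators $A:\mathcal H\rightrightarrows\mathcal H$ are maps assigning to each $x\in\mathcal H$ a subset $A(x)\subseteq\mathcal H$; sums and scalar multiples are taken pointwise (Minkowski), $\operatorname{ran}A=\bigcup_{z}A(z)$, and $\operatorname{Fix}A=\{x: x\in A(x)\}$. $A$ is \emph{maximally monotone} if for all $(x,u)\in\mathcal H\times\mathcal H$: $u\in A(x)$ if and only if $\langle x-y,u-v\rangle\ge 0$ for all $y\in\mathcal H$ and $v\in A(y)$. The \emph{resolvent} of $A$ is $J_A=(\operatorname{Id}+A)^{-1}$, i.e. $J_A(x)=\{y: x\in y+A(y)\}$, and for $w\in\mathcal H$ the inner perturbation $A_w$ is $A_w(x)=A(x-w)$. When a value of an operator is a singleton, it is identified with its element. \textbf{Theorem (AAMR splitting algorithm).} Let $A,B:\mathcal H\rightrightarrows\mathcal H$ be maximally monotone, let $\gamma>0$, let $(\lambda_n)_{n\ge0}$ be a sequence in $[0,1]$ with $\sum_{n\ge0}\lambda_n(1-\lambda_n)=+\infty$, let $\beta\in\,]0,1[$, and suppose that $q\in\operatorname{ran}\bigl(\operatorname{Id}+\tfrac{\gamma}{2(1-\beta)}(A+B)\bigr)$.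 Put $$T=(2\beta J_{\gamma B_{-q}}-\operatorname{Id})(2\beta J_{\gamma A_{-q}}-\operatorname{Id}).$$ Then $T$ is single-valued with full domain. Moreover, for any $x_0\in\mathcal H$, let $$x_{n+1}=(1-\lambda_n)x_n+\lambda_nT(x_n),\qquad n=0,1,2,\dots$$ Then there exists $x^\star\in\operatorname{Fix}T$ such that: (i) $x_{n+1}-x_n\to0$ strongly; (ii) $x_n\rightharpoonup x^\star$ weakly, and $J_{\gamma A}(q+x^\star)=J_{\frac{\gamma}{2(1-\beta)}(A+B)}(q)$; (iii) $J_{\gamma A}(q+x_n)\to J_{\frac{\gamma}{2(1-\beta)}(A+B)}(q)$ strongly, where all resolvent values appearing in (ii) and (iii) are singletons. -/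

import Mathlib

open Filter Topology
open scoped Pointwise

/-- A set-valued operator on `H`. Sums `A + B`, differences `A - B` and multiples `c • A` are taken
pointwise, with Minkowski sums, differences and dilations of the values. -/
abbrev SetOp (H : Type*) : Type _ := H → Set H

namespace SetOp

/-- The identity, as a set-valued operator. -/
def ident (H : Type*) : SetOp H := fun x => {x}

/-- The range of a set-valued operator. -/
def ran {H : Type*} (A : SetOp H) : Set H := {u | ∃ z, u ∈ A z}

/-- The fixed points of a set-valued operator. -/
def fix {H : Type*} (A : SetOp H) : Set H := {x | x ∈ A x}

/-- The composition of set-valued operators, `x ↦ ⋃_{y ∈ T x} S y`. -/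
def comp {H : Type*} (S T : SetOp H) : SetOp H := fun x => ⋃ y ∈ T x, S y

/-- The inner perturbation `A_w`, that is `x ↦ A (x - w)`. -/
def innerPert {H : Type*} [AddGroup H] (A : SetOp H) (w : H) : SetOp H := fun x => A (x - w)

/-- Maximal monotonicity: a pair `(x, u)` belongs to the graph of `A` exactly when it is
monotonically related to every pair of the graph. (The forward direction is monotonicity.) -/
def IsMaxMonotone {H : Type*} [NormedAddCommGroup H] [InnerProductSpace ℝ H] (A : SetOp H) : Prop :=
  ∀ x u : H, u ∈ A x ↔ ∀ y v : H, v ∈ A y → 0 ≤ inner ℝ (x - y) (u - v)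

/-- The resolvent `(Id + A)⁻¹` as a set-valued operator. -/
def resolvent {H : Type*} [AddGroup H] (A : SetOp H) : SetOp H :=
  fun x => {y | x ∈ (ident H + A) y}

/-- The modified reflected resolvent `2 β J_A - Id`. -/
def modReflRes {H : Type*} [NormedAddCommGroup H] [InnerProductSpace ℝ H] (β : ℝ) (A : SetOp H) :
    SetOp H :=
  (2 * β) • resolvent A - ident H

/-- The operator `(2 β J_{γ B_{-q}} - Id) (2 β J_{γ A_{-q}} - Id)`. -/
def aamr {H : Type*} [NormedAddCommGroup H] [InnerProductSpace ℝ H] (A B : SetOp H) (γ β : ℝ)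
    (q : H) : SetOp H :=
  comp (modReflRes β (γ • innerPert B (-q))) (modReflRes β (γ • innerPert A (-q)))

end SetOp

/-!
By Minty's theorem (`SetOp.IsMaxMonotone.exists_resolvent_eq`) the resolvents of maximally monotone
operators are everywhere defined, single-valued and firmly nonexpansive. For `0 < β < 1` the
modified reflection `2 β J - Id` of a firmly nonexpansive `J` then satisfies
`‖R x - R y‖² ≤ ‖x - y‖² - 4 β (1 - β) ‖J x - J y‖²` (`SetOp.norm_modRefl_sub_sq_le`). Hence the
composition `T` of two of them is a nonexpansive function, and its nonexpansiveness has a margin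
that measures the variation of the inner resolvent.

A point `x` is fixed by `T` exactly when the two resolvents involved take the same value `a` there.
Adding the two resolvent inclusions shows that `a + q` then solves the resolvent equation for the
sum `A + B`, and conversely a solution `p` gives back a fixed point
(`SetOp.mem_resolvent_add_of_mem_of_mem`, `SetOp.exists_mem_resolvent_of_mem_resolvent_add`). The
range hypothesis on `q` thus says that `T` has a fixed point, so the Krasnosel'skiĭ–Mann iteration
has vanishing residuals (`tendsto_norm_residual_of_krasnoselskiiMann`) and converges weakly to a
fixed point (`exists_tendsto_inner_of_krasnoselskiiMann`, by Opial's lemma and demiclosedness).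

Strong convergence of the shadows `J (q + x n)` comes from the margin: up to a constant
factor, their squared distance to `J (q + x⋆)` is bounded by
`‖x n - x⋆‖² - ‖T (x n) - x⋆‖²`, which tends to `0` with the residual because `x` is bounded.

For Minty's theorem, the condition on `y` coming from one point of the graph describes a closed
ball, so weak compactness reduces the claim to finitely many points, where `y` is obtained by
maximizing a concave quadratic function on a simplex (`exists_forall_inner_nonpos_of_fintype`).
-/

/-! ### Weak limits in Hilbert space -/

section WeakLimits

variable {H : Type*} [NormedAddCommGroup H] [InnerProductSpace ℝ H]

/-- Bounded families in a Hilbert space have weak limits along ultrafilters. This is the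
Banach–Alaoglu theorem, transported to `H` by the Riesz representation. -/
theorem exists_weak_limit_of_norm_le [CompleteSpace H] {ι : Type*} (U : Ultrafilter ι)
    {f : ι → H} {R : ℝ} (hf : ∀ᶠ i in (U : Filter ι), ‖f i‖ ≤ R) :
    ∃ y : H, ∀ z, Tendsto (fun i => inner ℝ (f i) z) U (𝓝 (inner ℝ y z)) := by
  let g : ι → WeakDual ℝ H := fun i => StrongDual.toWeakDual (InnerProductSpace.toDual ℝ H (f i))
  obtain ⟨φ, -, hφ⟩ := (WeakDual.isCompact_closedBall (𝕜 := ℝ) (E := H) 0 R).ultrafilter_le_nhds'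
    (U.map g) (by
      change ∀ᶠ i in (U : Filter ι), g i ∈ _
      filter_upwards [hf] with i hi
      simpa [g] using hi)
  refine ⟨(InnerProductSpace.toDual ℝ H).symm (WeakDual.toStrongDual φ), fun z => ?_⟩
  have h := (WeakBilin.tendsto_iff_forall_eval_tendsto _
    ContinuousLinearMap.coe_injective).1 (show Tendsto g U (𝓝 φ) from hφ) z
  rw [InnerProductSpace.toDual_symm_apply]
  exact h

/-- In a Hilbert space, convergence of all inner products is weak convergence. -/
theorem tendsto_toWeakSpace_of_tendsto_inner [CompleteSpace H] {ι : Type*} {l : Filter ι}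
    {f : ι → H} {y : H} (h : ∀ z, Tendsto (fun i => inner ℝ (f i) z) l (𝓝 (inner ℝ y z))) :
    Tendsto (fun i => toWeakSpace ℝ H (f i)) l (𝓝 (toWeakSpace ℝ H y)) := by
  refine (WeakBilin.tendsto_iff_forall_eval_tendsto (topDualPairing ℝ H).flip ?_).2 fun φ => ?_
  · intro a b hab
    refine ext_inner_left ℝ fun v => ?_
    exact LinearMap.congr_fun hab (InnerProductSpace.toDual ℝ H v)
  · have e : ∀ v, inner ℝ v ((InnerProductSpace.toDual ℝ H).symm φ) = φ v := fun v => by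
      rw [real_inner_comm, InnerProductSpace.toDual_symm_apply]
    have hφ := h ((InnerProductSpace.toDual ℝ H).symm φ)
    simp only [e] at hφ
    exact hφ

/-- Opial's lemma. If `‖x n - z‖` converges for every `z ∈ C`, and every weak cluster point of the
bounded sequence `x` lies in `C`, then `x` converges weakly to a point of `C`. Weak convergence is
expressed by inner products, and cluster points by ultrafilters. -/
theorem exists_tendsto_inner_of_opial [CompleteSpace H] {C : Set H} {x : ℕ → H} {R : ℝ}
    (hR : ∀ n, ‖x n‖ ≤ R)
    (hlim : ∀ z ∈ C, ∃ L : ℝ, Tendsto (fun n => ‖x n - z‖) atTop (𝓝 L))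
    (hC : ∀ (U : Ultrafilter ℕ) (y : H), (U : Filter ℕ) ≤ atTop →
      (∀ z, Tendsto (fun n => inner ℝ (x n) z) U (𝓝 (inner ℝ y z))) → y ∈ C) :
    ∃ y ∈ C, ∀ z, Tendsto (fun n => inner ℝ (x n) z) atTop (𝓝 (inner ℝ y z)) := by
  obtain ⟨y, hy⟩ := exists_weak_limit_of_norm_le (Ultrafilter.of atTop)
    (Eventually.of_forall hR)
  have hyC := hC _ y (Ultrafilter.of_le _) hy
  refine ⟨y, hyC, fun z => (tendsto_iff_ultrafilter _ _ _).2 fun U hU => ?_⟩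
  obtain ⟨y', hy'⟩ := exists_weak_limit_of_norm_le U (Eventually.of_forall hR)
  have hyC' := hC U y' hU hy'
  obtain ⟨L, hL⟩ := hlim y hyC
  obtain ⟨L', hL'⟩ := hlim y' hyC'
  -- The inner products against `y - y'` are affine in `‖x n - y‖ ^ 2 - ‖x n - y'‖ ^ 2`, so they
  -- converge along the whole sequence, and both cluster points give the same value.
  have key : Tendsto (fun n => inner ℝ (x n) (y - y')) atTop
      (𝓝 ((L' ^ 2 - L ^ 2 + ‖y‖ ^ 2 - ‖y'‖ ^ 2) / 2)) := by
    refine (((((hL'.pow 2).sub (hL.pow 2)).add_const (‖y‖ ^ 2)).sub_const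
      (‖y'‖ ^ 2)).div_const 2).congr fun n => ?_
    rw [norm_sub_sq_real, norm_sub_sq_real, inner_sub_right]
    ring
  have h1 := tendsto_nhds_unique (hy (y - y')) (key.mono_left (Ultrafilter.of_le _))
  have h2 := tendsto_nhds_unique (hy' (y - y')) (key.mono_left hU)
  have h3 : inner ℝ (y - y') (y - y') = (0 : ℝ) := by rw [inner_sub_left, h1, h2, sub_self]
  obtain rfl : y = y' := sub_eq_zero.1 (inner_self_eq_zero.1 h3)
  exact hy' z

/-- Demiclosedness of `Id - T` at `0` for a nonexpansive `T`. -/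
theorem eq_of_tendsto_inner_of_nonexpansive {ι : Type*} {l : Filter ι} [l.NeBot] {T : H → H}
    (hT : ∀ x y, ‖T x - T y‖ ≤ ‖x - y‖) {x : ι → H} {R : ℝ} (hR : ∀ i, ‖x i‖ ≤ R) {y : H}
    (hy : ∀ z, Tendsto (fun i => inner ℝ (x i) z) l (𝓝 (inner ℝ y z)))
    (hx : Tendsto (fun i => ‖T (x i) - x i‖) l (𝓝 0)) : T y = y := by
  have hb : ∀ i, ‖y - T y‖ ^ 2 ≤ -2 * (inner ℝ (x i) (y - T y) - inner ℝ y (y - T y)) +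
      2 * ‖T (x i) - x i‖ * (R + ‖y‖) + ‖T (x i) - x i‖ ^ 2 := by
    intro i
    have e : ‖x i - T y‖ ^ 2 = ‖x i - y‖ ^ 2 +
        2 * (inner ℝ (x i) (y - T y) - inner ℝ y (y - T y)) + ‖y - T y‖ ^ 2 := by
      rw [← inner_sub_left, ← norm_add_sq_real, sub_add_sub_cancel]
    have t1 : ‖x i - T y‖ ≤ ‖T (x i) - x i‖ + ‖x i - y‖ := by
      have := norm_sub_le_norm_sub_add_norm_sub (x i) (T (x i)) (T y)
      rw [norm_sub_rev (x i) (T (x i))] at this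
      linarith [hT (x i) y]
    have t2 : ‖x i - y‖ ≤ R + ‖y‖ := (norm_sub_le _ _).trans (by linarith [hR i])
    have t3 := pow_le_pow_left₀ (norm_nonneg _) t1 2
    have t4 := mul_le_mul_of_nonneg_left t2 (norm_nonneg (T (x i) - x i))
    nlinarith
  have ht : Tendsto (fun i => -2 * (inner ℝ (x i) (y - T y) - inner ℝ y (y - T y)) +
      2 * ‖T (x i) - x i‖ * (R + ‖y‖) + ‖T (x i) - x i‖ ^ 2) l (𝓝 0) := by
    have := (((((hy (y - T y)).sub_const (inner ℝ y (y - T y))).const_mul (-2)).add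
      ((hx.const_mul 2).mul_const (R + ‖y‖))).add (hx.pow 2))
    simpa using this
  have h0 : ‖y - T y‖ ^ 2 ≤ 0 := ge_of_tendsto' ht hb
  have h1 : ‖y - T y‖ = 0 := by nlinarith [norm_nonneg (y - T y)]
  exact (sub_eq_zero.1 (norm_eq_zero.1 h1)).symm

end WeakLimits

/-! ### The Krasnosel'skiĭ–Mann iteration -/

section KrasnoselskiiMann

variable {H : Type*} [NormedAddCommGroup H] [InnerProductSpace ℝ H]

theorem norm_convexComb_sub_sq (t : ℝ) (a b z : H) :
    ‖(1 - t) • a + t • b - z‖ ^ 2 =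
      (1 - t) * ‖a - z‖ ^ 2 + t * ‖b - z‖ ^ 2 - t * (1 - t) * ‖b - a‖ ^ 2 := by
  have e1 : (1 - t) • a + t • b - z = (a - z) + t • (b - a) := by module
  have e2 : b - z = (a - z) + (b - a) := by abel
  rw [e1, e2, norm_add_sq_real, norm_add_sq_real, norm_smul, inner_smul_right, mul_pow,
    Real.norm_eq_abs, sq_abs]
  ring

variable {T : H → H} {lam : ℕ → ℝ} {x : ℕ → H}

theorem antitone_norm_sub_of_krasnoselskiiMann {z : H}
    (hT : ∀ x y, ‖T x - T y‖ ≤ ‖x - y‖) (hz : T z = z) (hlam : ∀ n, lam n ∈ Set.Icc (0 : ℝ) 1)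
    (hx : ∀ n, x (n + 1) = (1 - lam n) • x n + lam n • T (x n)) :
    Antitone fun n => ‖x n - z‖ := by
  refine antitone_nat_of_succ_le fun n => ?_
  have e : x (n + 1) - z = (1 - lam n) • (x n - z) + lam n • (T (x n) - T z) := by
    rw [hx, hz]; module
  rw [e]
  refine (norm_add_le _ _).trans ?_
  rw [norm_smul, norm_smul, Real.norm_of_nonneg (hlam n).1,
    Real.norm_of_nonneg (sub_nonneg.2 (hlam n).2)]
  nlinarith [hT (x n) z, (hlam n).1]

/-- The residuals `T (x n) - x n` tend to `0`: their norms decrease, and they are square-summable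
with weights `λ (1 - λ)`, whose sum diverges. -/
theorem tendsto_norm_residual_of_krasnoselskiiMann {z : H}
    (hT : ∀ x y, ‖T x - T y‖ ≤ ‖x - y‖) (hz : T z = z) (hlam : ∀ n, lam n ∈ Set.Icc (0 : ℝ) 1)
    (hsum : Tendsto (fun N => ∑ n ∈ Finset.range N, lam n * (1 - lam n)) atTop atTop)
    (hx : ∀ n, x (n + 1) = (1 - lam n) • x n + lam n • T (x n)) :
    Tendsto (fun n => ‖T (x n) - x n‖) atTop (𝓝 0) := by
  have hanti : Antitone fun n => ‖T (x n) - x n‖ := by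
    refine antitone_nat_of_succ_le fun n => ?_
    have e : T (x (n + 1)) - x (n + 1) =
        (T (x (n + 1)) - T (x n)) + (1 - lam n) • (T (x n) - x n) := by
      rw [sub_add_eq_add_sub, hx]; module
    have e' : x (n + 1) - x n = lam n • (T (x n) - x n) := by rw [hx]; module
    have h1 := hT (x (n + 1)) (x n)
    rw [e', norm_smul, Real.norm_of_nonneg (hlam n).1] at h1
    rw [e]
    refine (norm_add_le _ _).trans ?_
    rw [norm_smul, Real.norm_of_nonneg (sub_nonneg.2 (hlam n).2)]
    linarith
  have hstep : ∀ n, lam n * (1 - lam n) * ‖T (x n) - x n‖ ^ 2 ≤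
      ‖x n - z‖ ^ 2 - ‖x (n + 1) - z‖ ^ 2 := by
    intro n
    have h1 := hT (x n) z
    rw [hz] at h1
    have h2 := pow_le_pow_left₀ (norm_nonneg _) h1 2
    rw [hx, norm_convexComb_sub_sq]
    nlinarith [(hlam n).1]
  have hbound : ∀ N, ∑ n ∈ Finset.range N, lam n * (1 - lam n) * ‖T (x n) - x n‖ ^ 2 ≤
      ‖x 0 - z‖ ^ 2 := by
    intro N
    refine (Finset.sum_le_sum fun n _ => hstep n).trans ?_
    rw [Finset.sum_range_sub' fun n => ‖x n - z‖ ^ 2]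
    linarith [sq_nonneg ‖x N - z‖]
  have hbdd : BddBelow (Set.range fun n => ‖T (x n) - x n‖) :=
    ⟨0, by rintro _ ⟨n, rfl⟩; exact norm_nonneg _⟩
  have hL := tendsto_atTop_ciInf hanti hbdd
  set L := ⨅ n, ‖T (x n) - x n‖
  have hL0 : 0 ≤ L := ge_of_tendsto' hL fun n => norm_nonneg _
  rcases hL0.eq_or_lt with h | hpos
  · rwa [← h] at hL
  · exfalso
    obtain ⟨N, hN⟩ := (hsum.eventually_gt_atTop (‖x 0 - z‖ ^ 2 / L ^ 2)).exists
    rw [div_lt_iff₀ (by positivity), Finset.sum_mul] at hN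
    refine absurd (hN.trans_le ((Finset.sum_le_sum fun n _ => ?_).trans (hbound N))) (lt_irrefl _)
    exact mul_le_mul_of_nonneg_left (pow_le_pow_left₀ hL0 (ciInf_le hbdd n) 2)
      (mul_nonneg (hlam n).1 (sub_nonneg.2 (hlam n).2))

theorem exists_tendsto_inner_of_krasnoselskiiMann [CompleteSpace H] {z : H}
    (hT : ∀ x y, ‖T x - T y‖ ≤ ‖x - y‖) (hz : T z = z) (hlam : ∀ n, lam n ∈ Set.Icc (0 : ℝ) 1)
    (hsum : Tendsto (fun N => ∑ n ∈ Finset.range N, lam n * (1 - lam n)) atTop atTop)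
    (hx : ∀ n, x (n + 1) = (1 - lam n) • x n + lam n • T (x n)) :
    ∃ y, T y = y ∧ ∀ w, Tendsto (fun n => inner ℝ (x n) w) atTop (𝓝 (inner ℝ y w)) := by
  have hR : ∀ n, ‖x n‖ ≤ ‖x 0 - z‖ + ‖z‖ := fun n => by
    have h1 := antitone_norm_sub_of_krasnoselskiiMann hT hz hlam hx (Nat.zero_le n)
    have h2 := norm_add_le (x n - z) z
    rw [sub_add_cancel] at h2
    exact h2.trans (by simpa using h1)
  refine exists_tendsto_inner_of_opial (C := {y | T y = y}) hR (fun w hw => ?_)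
    fun U y hU hy => ?_
  · exact ⟨_, tendsto_atTop_ciInf (antitone_norm_sub_of_krasnoselskiiMann hT hw hlam hx)
      ⟨0, by rintro _ ⟨n, rfl⟩; exact norm_nonneg _⟩⟩
  · exact eq_of_tendsto_inner_of_nonexpansive hT hR hy
      ((tendsto_norm_residual_of_krasnoselskiiMann hT hz hlam hsum hx).mono_left hU)

end KrasnoselskiiMann

/-! ### Minty's theorem -/

section Minty

variable {H : Type*} [NormedAddCommGroup H] [InnerProductSpace ℝ H]

/-- The finite case of Minty's theorem: a finite monotone family `(z i, v i)` admits a point `y`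
such that `(y, -y)` is monotonically related to all its members. With `c i = (z i - v i) / 2` one
may take `y = ∑ t i • c i`, where `t` maximizes the concave function
`t ↦ -‖∑ t i • c i‖ ^ 2 - ∑ t i * ⟪z i, v i⟫` on the standard simplex: by monotonicity its values
are nonpositive, and the first-order conditions at a maximizer bound `⟪y - z i, y + v i⟫` by the
maximum. -/
theorem exists_forall_inner_nonpos_of_fintype {ι : Type*} [Fintype ι] [Nonempty ι] (z v : ι → H)
    (hmono : ∀ i j, 0 ≤ inner ℝ (z i - z j) (v i - v j)) :
    ∃ y : H, ∀ i, inner ℝ (y - z i) (y + v i) ≤ 0 := by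
  classical
  let c : ι → H := fun i => (1 / 2 : ℝ) • (z i - v i)
  let Y : (ι → ℝ) → H := fun t => ∑ i, t i • c i
  let S : (ι → ℝ) → ℝ := fun t => ∑ i, t i * inner ℝ (z i) (v i)
  let g : (ι → ℝ) → ℝ := fun t => -‖Y t‖ ^ 2 - S t
  have hYc : Continuous Y := by fun_prop
  have hSc : Continuous S := by fun_prop
  have hgc : Continuous g := by fun_prop
  obtain ⟨t, ht, hmax⟩ := (isCompact_stdSimplex ℝ ι).exists_isMaxOn
    ⟨_, single_mem_stdSimplex ℝ (Classical.arbitrary ι)⟩ hgc.continuousOn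
  -- The maximum is nonpositive, since `∑ t i * t j * ⟪z i - z j, v i - v j⟫ ≥ 0`.
  have hg : g t ≤ 0 := by
    have hsum : 0 ≤ ∑ i, ∑ j, t i * t j * inner ℝ (z i - z j) (v i - v j) :=
      Finset.sum_nonneg fun i _ => Finset.sum_nonneg fun j _ =>
        mul_nonneg (mul_nonneg (ht.1 i) (ht.1 j)) (hmono i j)
    have hexp : ∑ i, ∑ j, t i * t j * inner ℝ (z i - z j) (v i - v j) =
        2 * S t - 2 * inner ℝ (∑ i, t i • z i) (∑ i, t i • v i) := by
      have h1 : ∀ i j, t i * t j * inner ℝ (z i - z j) (v i - v j) =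
          t j * (t i * inner ℝ (z i) (v i)) + t i * (t j * inner ℝ (z j) (v j))
            - t i * (t j * inner ℝ (z i) (v j)) - t j * (t i * inner ℝ (z j) (v i)) := by
        intro i j
        rw [inner_sub_left, inner_sub_right, inner_sub_right]
        ring
      have h2 : inner ℝ (∑ i, t i • z i) (∑ i, t i • v i) =
          ∑ i, ∑ j, t i * (t j * inner ℝ (z i) (v j)) := by
        simp only [sum_inner, inner_sum, real_inner_smul_left, real_inner_smul_right]
        rw [Finset.sum_comm]
        exact Finset.sum_congr rfl fun i _ => Finset.sum_congr rfl fun j _ => by ring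
      have h3 : inner ℝ (∑ i, t i • z i) (∑ i, t i • v i) =
          ∑ i, ∑ j, t j * (t i * inner ℝ (z j) (v i)) := by
        rw [h2, Finset.sum_comm]
      have h4 : S t = ∑ i, ∑ j, t j * (t i * inner ℝ (z i) (v i)) := by
        simp only [← Finset.sum_mul, ht.2, one_mul, S]
      have h5 : S t = ∑ i, ∑ j, t i * (t j * inner ℝ (z j) (v j)) := by
        rw [h4, Finset.sum_comm]
      simp only [h1, Finset.sum_sub_distrib, Finset.sum_add_distrib]
      rw [← h2, ← h3, ← h4, ← h5]
      ring
    have hY : Y t = (1 / 2 : ℝ) • (∑ i, t i • z i - ∑ i, t i • v i) := by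
      simp only [Y, c, ← Finset.sum_sub_distrib, Finset.smul_sum]
      exact Finset.sum_congr rfl fun i _ => by module
    have h6 := sq_nonneg ‖∑ i, t i • z i + ∑ i, t i • v i‖
    have h7 : ‖Y t‖ ^ 2 = (1 / 4 : ℝ) * ‖∑ i, t i • z i - ∑ i, t i • v i‖ ^ 2 := by
      rw [hY, norm_smul, mul_pow]; norm_num
    rw [norm_add_sq_real] at h6
    rw [norm_sub_sq_real] at h7
    change -‖Y t‖ ^ 2 - S t ≤ 0
    linarith
  refine ⟨Y t, fun i => ?_⟩
  -- First-order condition at `t` in the direction of the `i`-th vertex of the simplex.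
  have hfoc : -2 * inner ℝ (Y t) (c i - Y t) - inner ℝ (z i) (v i) + S t ≤ 0 := by
    have hs : ∀ s ∈ Set.Ioc (0 : ℝ) 1, -2 * inner ℝ (Y t) (c i - Y t) - inner ℝ (z i) (v i) + S t
        ≤ s * ‖c i - Y t‖ ^ 2 := by
      intro s hs
      let t' : ι → ℝ := (1 - s) • t + s • Pi.single i 1
      have ht' : t' ∈ stdSimplex ℝ ι := convex_stdSimplex ℝ ι ht (single_mem_stdSimplex ℝ i)
        (sub_nonneg.2 hs.2) hs.1.le (by ring)
      have hY' : Y t' = Y t + s • (c i - Y t) := by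
        have : Y t' = (1 - s) • Y t + s • c i := by
          simp only [Y, t', Pi.add_apply, Pi.smul_apply, smul_eq_mul, add_smul, mul_smul,
            Finset.sum_add_distrib, ← Finset.smul_sum, Pi.single_apply, ite_smul, one_smul,
            zero_smul, Finset.sum_ite_eq', Finset.mem_univ, if_true]
        rw [this]; module
      have hS' : S t' = S t + s * (inner ℝ (z i) (v i) - S t) := by
        have : S t' = (1 - s) * S t + s * inner ℝ (z i) (v i) := by
          simp only [S, t', Pi.add_apply, Pi.smul_apply, smul_eq_mul, add_mul, mul_assoc,
            Finset.sum_add_distrib, ← Finset.mul_sum, Pi.single_apply, ite_mul, one_mul,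
            zero_mul, Finset.sum_ite_eq', Finset.mem_univ, if_true]
        rw [this]; ring
      have hle : -‖Y t'‖ ^ 2 - S t' ≤ -‖Y t‖ ^ 2 - S t := hmax ht'
      rw [hY', hS', norm_add_sq_real, norm_smul, inner_smul_right, mul_pow, Real.norm_eq_abs,
        sq_abs] at hle
      refine le_of_mul_le_mul_left ?_ hs.1
      linarith
    have hlim : Tendsto (fun s : ℝ => s * ‖c i - Y t‖ ^ 2) (𝓝[>] 0) (𝓝 0) := by
      have : Tendsto (fun s : ℝ => s * ‖c i - Y t‖ ^ 2) (𝓝 0) (𝓝 (0 * ‖c i - Y t‖ ^ 2)) :=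
        tendsto_id.mul_const _
      rw [zero_mul] at this
      exact this.mono_left nhdsWithin_le_nhds
    refine ge_of_tendsto hlim ?_
    filter_upwards [Ioc_mem_nhdsGT (zero_lt_one' ℝ)] with s h using hs s h
  have hg' : -‖Y t‖ ^ 2 - S t ≤ 0 := hg
  have e1 : inner ℝ (Y t) (c i - Y t) =
      1 / 2 * (inner ℝ (Y t) (z i) - inner ℝ (Y t) (v i)) - ‖Y t‖ ^ 2 := by
    simp only [c, inner_sub_right, inner_smul_right, real_inner_self_eq_norm_sq]
  have e2 : inner ℝ (Y t - z i) (Y t + v i) = ‖Y t‖ ^ 2 + inner ℝ (Y t) (v i) -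
      inner ℝ (Y t) (z i) - inner ℝ (z i) (v i) := by
    rw [inner_sub_left, inner_add_right, inner_add_right, real_inner_self_eq_norm_sq,
      real_inner_comm (Y t) (z i)]
    ring
  rw [e1] at hfoc
  rw [e2]
  linarith

/-- Minty's theorem for a monotone set of pairs: some `(y, -y)` is monotonically related to all of
it. The condition at each pair confines `y` to a ball, so a weak limit of the points given by the
finite case satisfies all the conditions. -/
theorem exists_forall_inner_nonpos_of_monotone [CompleteSpace H] {G : Set (H × H)}
    (hG : ∀ p ∈ G, ∀ r ∈ G, 0 ≤ inner ℝ (p.1 - r.1) (p.2 - r.2)) :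
    ∃ y : H, ∀ p ∈ G, inner ℝ (y - p.1) (y + p.2) ≤ 0 := by
  classical
  rcases G.eq_empty_or_nonempty with rfl | ⟨p₀, hp₀⟩
  · exact ⟨0, by simp⟩
  have hfin : ∀ F : Finset G, ∃ y : H, ∀ p ∈ F, inner ℝ (y - p.1.1) (y + p.1.2) ≤ 0 := by
    intro F
    rcases F.eq_empty_or_nonempty with rfl | hF
    · exact ⟨0, by simp⟩
    · have : Nonempty F := hF.to_subtype
      obtain ⟨y, hy⟩ := exists_forall_inner_nonpos_of_fintype (ι := F)
        (fun i => i.1.1.1) (fun i => i.1.1.2) fun i j => hG _ i.1.2 _ j.1.2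
      exact ⟨y, fun p hp => hy ⟨p, hp⟩⟩
  choose f hf using hfin
  let U : Ultrafilter (Finset G) := Ultrafilter.of atTop
  have hmem : ∀ p : G, ∀ᶠ F in (U : Filter (Finset G)),
      inner ℝ (f F - p.1.1) (f F + p.1.2) ≤ 0 := by
    intro p
    refine Filter.Eventually.filter_mono (Ultrafilter.of_le atTop) ?_
    filter_upwards [eventually_ge_atTop {p}] with F hF
    exact hf F p (hF (Finset.mem_singleton_self p))
  have hexp : ∀ y a b : H, inner ℝ (y - a) (y + b) = ‖y‖ ^ 2 + inner ℝ y (b - a) - inner ℝ a b := by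
    intro y a b
    rw [inner_sub_left, inner_add_right, inner_add_right, real_inner_self_eq_norm_sq,
      inner_sub_right, real_inner_comm y a]
    ring
  have hbdd : ∀ᶠ F in (U : Filter (Finset G)),
      ‖f F‖ ≤ 1 + ‖p₀.2 - p₀.1‖ + |inner ℝ p₀.1 p₀.2| := by
    filter_upwards [hmem ⟨p₀, hp₀⟩] with F hF
    rw [hexp] at hF
    have h1 := neg_le_of_abs_le (abs_real_inner_le_norm (f F) (p₀.2 - p₀.1))
    have h2 := le_abs_self (inner ℝ p₀.1 p₀.2)
    by_contra! hlt
    have h3 := abs_nonneg (inner ℝ p₀.1 p₀.2)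
    have h4 := norm_nonneg (p₀.2 - p₀.1)
    nlinarith
  obtain ⟨y, hy⟩ := exists_weak_limit_of_norm_le U hbdd
  refine ⟨y, fun p hp => ?_⟩
  have hlim : Tendsto (fun F => 2 * inner ℝ (f F) y - ‖y‖ ^ 2 + inner ℝ (f F) (p.2 - p.1) -
      inner ℝ p.1 p.2) U (𝓝 (2 * inner ℝ y y - ‖y‖ ^ 2 + inner ℝ y (p.2 - p.1) -
      inner ℝ p.1 p.2)) :=
    ((((hy y).const_mul 2).sub_const _).add (hy _)).sub_const _
  have h := le_of_tendsto hlim (b := 0) (by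
    filter_upwards [hmem ⟨p, hp⟩] with F hF
    rw [hexp] at hF
    have h1 := sq_nonneg ‖f F - y‖
    rw [norm_sub_sq_real] at h1
    linarith)
  rw [real_inner_self_eq_norm_sq] at h
  rw [hexp]
  linarith

end Minty

namespace SetOp

/-! ### Resolvents -/

section Resolvent

variable {H : Type*} [NormedAddCommGroup H] [InnerProductSpace ℝ H] {A : SetOp H} {γ : ℝ}

theorem mem_resolvent_smul {x y : H} :
    y ∈ resolvent (γ • A) x ↔ ∃ u ∈ A y, y + γ • u = x := by
  change x ∈ {y} + γ • A y ↔ _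
  simp only [Set.mem_add, Set.mem_singleton_iff, exists_eq_left, Set.mem_smul_set,
    exists_exists_and_eq_and]

theorem resolvent_smul_innerPert_neg {q x : H} :
    resolvent (γ • innerPert A (-q)) x = {y | y + q ∈ resolvent (γ • A) (x + q)} := by
  ext y
  simp only [mem_resolvent_smul, innerPert, sub_neg_eq_add, Set.mem_ofPred_eq,
    add_right_comm y q, add_left_inj]

theorem IsMaxMonotone.inner_nonneg (hA : IsMaxMonotone A) {x y u v : H} (hu : u ∈ A x)
    (hv : v ∈ A y) : 0 ≤ inner ℝ (x - y) (u - v) :=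
  (hA x u).1 hu y v hv

theorem norm_sub_sq_le_inner_of_mem_resolvent (hA : IsMaxMonotone A) (hγ : 0 < γ) {x x' y y' : H}
    (hy : y ∈ resolvent (γ • A) x) (hy' : y' ∈ resolvent (γ • A) x') :
    ‖y - y'‖ ^ 2 ≤ inner ℝ (y - y') (x - x') := by
  obtain ⟨u, hu, rfl⟩ := mem_resolvent_smul.1 hy
  obtain ⟨v, hv, rfl⟩ := mem_resolvent_smul.1 hy'
  have e : y + γ • u - (y' + γ • v) = (y - y') + γ • (u - v) := by module
  rw [e, inner_add_right, inner_smul_right, real_inner_self_eq_norm_sq]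
  linarith [mul_nonneg hγ.le (hA.inner_nonneg hu hv)]

theorem IsMaxMonotone.resolvent_nonempty [CompleteSpace H] (hA : IsMaxMonotone A) (hγ : 0 < γ)
    (x : H) : (resolvent (γ • A) x).Nonempty := by
  obtain ⟨y, hy⟩ := exists_forall_inner_nonpos_of_monotone
    (G := {p | ∃ u ∈ A p.1, p.2 = γ • u - x}) (by
      rintro ⟨a, _⟩ ⟨u, hu, rfl⟩ ⟨b, _⟩ ⟨v, hv, rfl⟩
      have e : γ • u - x - (γ • v - x) = γ • (u - v) := by module
      dsimp only
      rw [e, inner_smul_right]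
      exact mul_nonneg hγ.le (hA.inner_nonneg hu hv))
  refine ⟨y, mem_resolvent_smul.2 ⟨γ⁻¹ • (x - y), (hA _ _).2 fun z v hv => ?_, ?_⟩⟩
  · have h := hy (z, γ • v - x) ⟨v, hv, rfl⟩
    have e : γ⁻¹ • (x - y) - v = -(γ⁻¹ • (y + (γ • v - x))) := by
      rw [smul_add, smul_sub, smul_sub, inv_smul_smul₀ hγ.ne']; module
    rw [e, inner_neg_right, inner_smul_right, neg_nonneg]
    exact mul_nonpos_of_nonneg_of_nonpos (inv_nonneg.2 hγ.le) h
  · rw [smul_inv_smul₀ hγ.ne', add_sub_cancel]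

/-- The resolvent of a maximally monotone operator is a firmly nonexpansive function. -/
theorem IsMaxMonotone.exists_resolvent_eq [CompleteSpace H] (hA : IsMaxMonotone A) (hγ : 0 < γ) :
    ∃ J : H → H, (∀ x, resolvent (γ • A) x = {J x}) ∧
      ∀ x y, ‖J x - J y‖ ^ 2 ≤ inner ℝ (J x - J y) (x - y) := by
  choose J hJ using hA.resolvent_nonempty hγ
  refine ⟨J, fun x => ?_, fun x y => norm_sub_sq_le_inner_of_mem_resolvent hA hγ (hJ x) (hJ y)⟩
  refine Set.eq_singleton_iff_unique_mem.2 ⟨hJ x, fun y hy => ?_⟩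
  have h := norm_sub_sq_le_inner_of_mem_resolvent hA hγ hy (hJ x)
  rw [sub_self, inner_zero_right] at h
  exact sub_eq_zero.1 (norm_eq_zero.1 (by nlinarith [norm_nonneg (y - J x)]))

/-- The resolvent of a positive multiple of a sum of two monotone operators takes at most one
value, although the sum need not be maximally monotone. -/
theorem resolvent_smul_add_eq_singleton {B : SetOp H} (hA : IsMaxMonotone A) (hB : IsMaxMonotone B)
    (hγ : 0 < γ) {x p : H} (hp : p ∈ resolvent (γ • (A + B)) x) :
    resolvent (γ • (A + B)) x = {p} := by
  refine Set.eq_singleton_iff_unique_mem.2 ⟨hp, fun y hy => ?_⟩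
  obtain ⟨_, ⟨u, hu, v, hv, rfl⟩, hx⟩ := mem_resolvent_smul.1 hp
  obtain ⟨_, ⟨u', hu', v', hv', rfl⟩, hx'⟩ := mem_resolvent_smul.1 hy
  have e : y - p = -(γ • ((u' - u) + (v' - v))) := by
    rw [← sub_eq_zero, ← sub_eq_zero.2 (hx'.trans hx.symm)]
    simp only
    module
  have h : ‖y - p‖ ^ 2 ≤ 0 := by
    have h1 := hA.inner_nonneg hu' hu
    have h2 := hB.inner_nonneg hv' hv
    rw [← real_inner_self_eq_norm_sq]
    nth_rewrite 2 [e]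
    rw [inner_neg_right, inner_smul_right, inner_add_right, neg_nonpos]
    exact mul_nonneg hγ.le (add_nonneg h1 h2)
  exact sub_eq_zero.1 (norm_eq_zero.1 (by nlinarith [norm_nonneg (y - p)]))

theorem modReflRes_eq_singleton {β : ℝ} {x y : H} (h : resolvent A x = {y}) :
    modReflRes β A x = {(2 * β) • y - x} := by
  simp [modReflRes, ident, h]

end Resolvent

/-! ### The averaged alternating modified reflections operator -/

section AAMR

variable {H : Type*} [NormedAddCommGroup H] [InnerProductSpace ℝ H]

/-- For a firmly nonexpansive `J`, the modified reflection `2 β J - Id` is nonexpansive, with a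
margin controlled by the variation of `J`. -/
theorem norm_modRefl_sub_sq_le {J : H → H} {β : ℝ} (hβ : 0 < β)
    (hJ : ∀ x y, ‖J x - J y‖ ^ 2 ≤ inner ℝ (J x - J y) (x - y)) (x y : H) :
    ‖((2 * β) • J x - x) - ((2 * β) • J y - y)‖ ^ 2 ≤
      ‖x - y‖ ^ 2 - 4 * β * (1 - β) * ‖J x - J y‖ ^ 2 := by
  have e : ((2 * β) • J x - x) - ((2 * β) • J y - y) = (2 * β) • (J x - J y) - (x - y) := by module
  rw [e, norm_sub_sq_real, norm_smul, real_inner_smul_left, mul_pow, Real.norm_eq_abs, sq_abs]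
  nlinarith [mul_le_mul_of_nonneg_left (hJ x y) hβ.le]

theorem aamr_eq_singleton {A B : SetOp H} {γ β : ℝ} {q x : H} {JA JB : H → H}
    (hJA : ∀ x, resolvent (γ • innerPert A (-q)) x = {JA x})
    (hJB : ∀ x, resolvent (γ • innerPert B (-q)) x = {JB x}) :
    aamr A B γ β q x = {(2 * β) • JB ((2 * β) • JA x - x) - ((2 * β) • JA x - x)} := by
  simp [aamr, comp, modReflRes_eq_singleton (hJA _), modReflRes_eq_singleton (hJB _)]

/-- If the two shadows of `x` in the composition agree, that is if `x` is a fixed point, then the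
common shadow, translated by `q`, solves the resolvent equation for the sum: adding the inclusions
`x - a ∈ γ A (a + q)` and `(2 β - 1) a - x ∈ γ B (a + q)` eliminates `x`. -/
theorem mem_resolvent_add_of_mem_of_mem {A B : SetOp H} {γ β : ℝ} {q x a : H} (hβ : β ≠ 1)
    (hA : a ∈ resolvent (γ • innerPert A (-q)) x)
    (hB : a ∈ resolvent (γ • innerPert B (-q)) ((2 * β) • a - x)) :
    a + q ∈ resolvent ((γ / (2 * (1 - β))) • (A + B)) q := by
  obtain ⟨u, hu, hx⟩ := mem_resolvent_smul.1 hA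
  obtain ⟨v, hv, hx'⟩ := mem_resolvent_smul.1 hB
  simp only [innerPert, sub_neg_eq_add] at hu hv
  refine mem_resolvent_smul.2 ⟨u + v, Set.add_mem_add hu hv, ?_⟩
  have hne : 2 * (1 - β) ≠ 0 := mul_ne_zero two_ne_zero (sub_ne_zero.2 hβ.symm)
  have e : γ • (u + v) = (2 * (1 - β)) • -a := by
    have h1 : γ • u = x - a := eq_sub_of_add_eq' hx
    have h2 : γ • v = (2 * β) • a - x - a := eq_sub_of_add_eq' hx'
    rw [smul_add, h1, h2]
    module
  rw [div_eq_inv_mul, mul_smul, e, inv_smul_smul₀ hne]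
  abel

/-- Conversely, a solution of the resolvent equation for the sum yields a fixed point, namely
`p - q + γ u` for the component `u ∈ A p`. -/
theorem exists_mem_resolvent_of_mem_resolvent_add {A B : SetOp H} {γ β : ℝ} {q p : H} (hβ : β ≠ 1)
    (hp : p ∈ resolvent ((γ / (2 * (1 - β))) • (A + B)) q) :
    ∃ x, p - q ∈ resolvent (γ • innerPert A (-q)) x ∧
      p - q ∈ resolvent (γ • innerPert B (-q)) ((2 * β) • (p - q) - x) := by
  obtain ⟨_, ⟨u, hu, v, hv, rfl⟩, hq⟩ := mem_resolvent_smul.1 hp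
  have hne : 2 * (1 - β) ≠ 0 := mul_ne_zero two_ne_zero (sub_ne_zero.2 hβ.symm)
  have e : γ • (u + v) = (2 * (1 - β)) • (q - p) := by
    rw [← eq_sub_of_add_eq' hq, ← mul_smul, mul_div_cancel₀ _ hne]
  refine ⟨p - q + γ • u, mem_resolvent_smul.2 ⟨u, by simpa [innerPert] using hu, rfl⟩,
    mem_resolvent_smul.2 ⟨v, by simpa [innerPert] using hv, ?_⟩⟩
  have e' : γ • v = (2 * (1 - β)) • (q - p) - γ • u := by rw [← e]; module
  rw [e']
  module

end AAMR

end SetOp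

theorem mainTheorem1 {H : Type*} [NormedAddCommGroup H] [InnerProductSpace ℝ H] [CompleteSpace H]
    (A B : SetOp H) (hA : SetOp.IsMaxMonotone A) (hB : SetOp.IsMaxMonotone B)
    (γ : ℝ) (hγ : 0 < γ)
    (lam : ℕ → ℝ) (hlam : ∀ n, lam n ∈ Set.Icc (0 : ℝ) 1)
    (hsum : Tendsto (fun N => ∑ n ∈ Finset.range N, lam n * (1 - lam n)) atTop atTop)
    (β : ℝ) (hβ : β ∈ Set.Ioo (0 : ℝ) 1)
    (q : H) (hq : q ∈ SetOp.ran (SetOp.ident H + (γ / (2 * (1 - β))) • (A + B))) :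
    -- the iteration is well defined: its operator is single-valued with full domain
    (∀ u : H, ∃ v : H, SetOp.aamr A B γ β q u = {v}) ∧
    ∀ x : ℕ → H,
      (∀ n, x (n + 1) ∈ (1 - lam n) • ({x n} : Set H) + lam n • SetOp.aamr A B γ β q (x n)) →
      ∃ xs ∈ SetOp.fix (SetOp.aamr A B γ β q),
        Tendsto (fun n => x (n + 1) - x n) atTop (𝓝 0) ∧
        Tendsto (fun n => toWeakSpace ℝ H (x n)) atTop (𝓝 (toWeakSpace ℝ H xs)) ∧
        ∃ p : H,
          SetOp.resolvent ((γ / (2 * (1 - β))) • (A + B)) q = {p} ∧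
          SetOp.resolvent (γ • A) (q + xs) = {p} ∧
          ∃ y : ℕ → H,
            (∀ n, SetOp.resolvent (γ • A) (q + x n) = {y n}) ∧
            Tendsto y atTop (𝓝 p) := by
  have hβ0 : 0 < β := hβ.1
  have hβ1 : 0 < 1 - β := sub_pos.2 hβ.2
  have hβne : β ≠ 1 := hβ.2.ne
  obtain ⟨KA, hKA, hKA'⟩ := hA.exists_resolvent_eq hγ
  obtain ⟨KB, hKB, hKB'⟩ := hB.exists_resolvent_eq hγ
  obtain ⟨p, hp⟩ : ∃ p, p ∈ SetOp.resolvent ((γ / (2 * (1 - β))) • (A + B)) q := hq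
  have hpS := SetOp.resolvent_smul_add_eq_singleton hA hB (div_pos hγ (mul_pos two_pos hβ1)) hp
  set JA : H → H := fun x => KA (x + q) - q with hJA_def
  set JB : H → H := fun x => KB (x + q) - q with hJB_def
  have hJA : ∀ x, SetOp.resolvent (γ • SetOp.innerPert A (-q)) x = {JA x} := fun x => by
    ext y
    simp [SetOp.resolvent_smul_innerPert_neg, hKA, hJA_def, eq_sub_iff_add_eq]
  have hJB : ∀ x, SetOp.resolvent (γ • SetOp.innerPert B (-q)) x = {JB x} := fun x => by
    ext y
    simp [SetOp.resolvent_smul_innerPert_neg, hKB, hJB_def, eq_sub_iff_add_eq]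
  have hJA' : ∀ x y, ‖JA x - JA y‖ ^ 2 ≤ inner ℝ (JA x - JA y) (x - y) := fun x y => by
    simpa [hJA_def] using hKA' (x + q) (y + q)
  have hJB' : ∀ x y, ‖JB x - JB y‖ ^ 2 ≤ inner ℝ (JB x - JB y) (x - y) := fun x y => by
    simpa [hJB_def] using hKB' (x + q) (y + q)
  set T : H → H := fun x => (2 * β) • JB ((2 * β) • JA x - x) - ((2 * β) • JA x - x) with hT_def
  have hT : ∀ x, SetOp.aamr A B γ β q x = {T x} := fun x => SetOp.aamr_eq_singleton hJA hJB
  have hTA : ∀ x y, ‖T x - T y‖ ^ 2 ≤ ‖x - y‖ ^ 2 - 4 * β * (1 - β) * ‖JA x - JA y‖ ^ 2 := by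
    intro x y
    have h1 := SetOp.norm_modRefl_sub_sq_le hβ0 hJB' ((2 * β) • JA x - x) ((2 * β) • JA y - y)
    have h2 := SetOp.norm_modRefl_sub_sq_le hβ0 hJA' x y
    have h3 : 0 ≤ 4 * β * (1 - β) * ‖JB ((2 * β) • JA x - x) - JB ((2 * β) • JA y - y)‖ ^ 2 := by
      positivity
    exact h1.trans (by linarith)
  have hTne : ∀ x y, ‖T x - T y‖ ≤ ‖x - y‖ := fun x y => by
    refine (sq_le_sq₀ (norm_nonneg _) (norm_nonneg _)).1
      ((hTA x y).trans (sub_le_self _ (by positivity)))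
  -- `x` is fixed exactly when its shadow under `A` is also the shadow under `B`.
  have hfix : ∀ x, T x = x ↔ JB ((2 * β) • JA x - x) = JA x := by
    intro x
    have e : T x - x = (2 * β) • (JB ((2 * β) • JA x - x) - JA x) := by
      simp only [hT_def]; module
    rw [← sub_eq_zero, e, smul_eq_zero_iff_right (by positivity), sub_eq_zero]
  have hfixp : ∀ x, T x = x → KA (q + x) = p := by
    intro x hx
    have h : JA x + q ∈ SetOp.resolvent ((γ / (2 * (1 - β))) • (A + B)) q :=
      SetOp.mem_resolvent_add_of_mem_of_mem hβne (by rw [hJA]; rfl)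
        (by rw [hJB, (hfix x).1 hx]; rfl)
    rw [hpS, Set.mem_singleton_iff] at h
    rw [← h, hJA_def, sub_add_cancel, add_comm]
  obtain ⟨z, hz⟩ : ∃ z, T z = z := by
    obtain ⟨z, hz1, hz2⟩ := SetOp.exists_mem_resolvent_of_mem_resolvent_add hβne hp
    rw [hJA, Set.mem_singleton_iff] at hz1
    rw [hJB, Set.mem_singleton_iff, hz1] at hz2
    exact ⟨z, (hfix z).2 hz2.symm⟩
  refine ⟨fun u => ⟨T u, hT u⟩, fun x hx => ?_⟩
  have hx' : ∀ n, x (n + 1) = (1 - lam n) • x n + lam n • T (x n) := fun n => by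
    simpa [hT] using hx n
  have hres := tendsto_norm_residual_of_krasnoselskiiMann hTne hz hlam hsum hx'
  obtain ⟨xs, hxs, hweak⟩ := exists_tendsto_inner_of_krasnoselskiiMann hTne hz hlam hsum hx'
  refine ⟨xs, ?_, ?_, tendsto_toWeakSpace_of_tendsto_inner hweak, p, hpS, ?_,
    fun n => KA (q + x n), fun n => hKA _, ?_⟩
  · change xs ∈ SetOp.aamr A B γ β q xs
    rw [hT, hxs]
    rfl
  · refine squeeze_zero_norm (fun n => ?_) hres
    have e : x (n + 1) - x n = lam n • (T (x n) - x n) := by rw [hx']; module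
    rw [e, norm_smul, Real.norm_of_nonneg (hlam n).1]
    exact mul_le_of_le_one_left (norm_nonneg _) (hlam n).2
  · rw [hKA, hfixp xs hxs]
  · -- The decrease of `‖x n - xs‖ ^ 2` under `T` dominates the squared error of the shadows, and is
    -- itself controlled by the residual `‖T (x n) - x n‖`.
    have hb : ∀ n, ‖KA (q + x n) - p‖ ^ 2 ≤
        (4 * β * (1 - β))⁻¹ * (2 * ‖x 0 - xs‖ * ‖T (x n) - x n‖) := by
      intro n
      have h1 := hTA (x n) xs
      have e : JA (x n) - JA xs = KA (q + x n) - p := by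
        rw [← hfixp xs hxs]; simp [hJA_def, add_comm]
      rw [hxs, e] at h1
      have h2 : ‖x n - xs‖ ≤ ‖x 0 - xs‖ :=
        antitone_norm_sub_of_krasnoselskiiMann hTne hxs hlam hx' (Nat.zero_le n)
      have h3 : ‖x n - xs‖ ≤ ‖T (x n) - x n‖ + ‖T (x n) - xs‖ := by
        rw [norm_sub_rev (T (x n)) (x n)]
        exact norm_sub_le_norm_sub_add_norm_sub _ _ _
      have h4 : ‖T (x n) - xs‖ ≤ ‖x n - xs‖ := by simpa [hxs] using hTne (x n) xs
      rw [le_inv_mul_iff₀ (by positivity)]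
      have h5 : (‖x n - xs‖ - ‖T (x n) - xs‖) * (‖x n - xs‖ + ‖T (x n) - xs‖) ≤
          ‖T (x n) - x n‖ * (2 * ‖x 0 - xs‖) :=
        mul_le_mul (by linarith) (by linarith) (by positivity) (norm_nonneg _)
      linarith
    have h0 : Tendsto (fun n => ‖KA (q + x n) - p‖ ^ 2) atTop (𝓝 0) := by
      refine squeeze_zero (fun n => by positivity) hb ?_
      simpa using (hres.const_mul (2 * ‖x 0 - xs‖)).const_mul (4 * β * (1 - β))⁻¹
    rw [tendsto_iff_norm_sub_tendsto_zero]
    simpa using h0.sqrt
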